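/- Let $G$ be a compact Hausdorff right topological group, i.e. a group with a compact Hausdorff topology for which $x\mapsto xg$ is continuous for every $g\in G$. Let $M(G)=C(G)^*$ be the Banach space of complex Radon measures on $G$ with the total variation norm. For $\mu\in M(G)$ and $g\in G$ let $\mu_g(E)=\mu(Eg)$, i.e. $\int f\,d\mu_g=\int f(xg^{-1})\,d\mu(x)$ for $f\in C(G)$, and let $\mu_G=\{\mu_g : g\in G\}$ be the right orbit of $\mu$. Define $$M_c(G)=\Big\{\mu\in M(G) : y\mapsto \int f(xy)\,d\mu(x)\ \text{is continuous on } G \text{ for every } f\in C(G)\Big\},$$ $$L^c(G)=\{\mu\in M_c(G) : x\mapsto \mu_{x^{-1}} \text{ is norm continuous from } G \text{ to } M(G)\},$$ $$M_w(G)=\{\mu\in M_c(G) : \mu_G \text{ is relatively weakly compact in } M(G)\}.$$ A Haar measure on $G$ is a Radon probability measure $\lambda$ on the Borel sets of $G$ with $\lambda(Eg)=\lambda(E)$ for all $g\in G$ and all Borel sets $E\subseteq G$. Then the following are equivalent: 1. $G$ has a Haar measure; 2. $L^c(G)$ contains a non-zero measure; 3. $M_w(G)$ contains a non-zero measure. 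-/

import Mathlib

open MeasureTheory

/-- A right topological group: a group with a topology for which every right translation
`x ↦ x * g` is continuous. Nothing is assumed about left translations or inversion. -/
class IsRightTopologicalGroup (G : Type*) [TopologicalSpace G] [Group G] : Prop where
  continuous_mul_right : ∀ g : G, Continuous fun x : G => x * g

/-- A (right) Haar measure on a compact right topological group: a Radon probability measure
`m` on the Borel sets with `m (E g) = m E` for every `g` and every Borel set `E`. -/
structure IsRightHaarMeasure {G : Type*} [TopologicalSpace G] [Group G] [MeasurableSpace G]
    (m : Measure G) : Prop where
  regular : m.Regular
  isProbabilityMeasure : IsProbabilityMeasure m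
  right_invariant : ∀ (g : G) (E : Set G), MeasurableSet E → m ((fun x => x * g) '' E) = m E

/-- `M(G)`, the complex Radon measures on the compact space `G`: the dual Banach space of
`C(G, ℂ)`, so that `μ f` stands for `∫ f dμ` and the norm is the total variation norm. -/
abbrev RadonDual (G : Type*) [TopologicalSpace G] [CompactSpace G] : Type _ :=
  StrongDual ℂ C(G, ℂ)

section Translation

variable {G : Type*} [TopologicalSpace G] [Group G] [IsRightTopologicalGroup G]

/-- The right translate `R_g f`, that is `x ↦ f (x * g)`. -/
noncomputable def rightTranslateFun (g : G) (f : C(G, ℂ)) : C(G, ℂ) :=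
  f.comp ⟨fun x => x * g, IsRightTopologicalGroup.continuous_mul_right g⟩

/-- `R_g` as a bounded linear operator on `C(G, ℂ)`. -/
noncomputable def rightTranslateCLM [CompactSpace G] (g : G) : C(G, ℂ) →L[ℂ] C(G, ℂ) :=
  LinearMap.mkContinuous
    { toFun := rightTranslateFun g
      map_add' := fun _ _ => rfl
      map_smul' := fun _ _ => rfl } 1
    (fun f => by
      rw [one_mul]
      exact (ContinuousMap.norm_le _ (norm_nonneg f)).2 fun x => f.norm_coe_le_norm (x * g))

variable [CompactSpace G]

/-- The translate `μ_g` of a measure, `μ_g (E) = μ (E g)`; as a functional,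
`∫ f dμ_g = ∫ f (x g⁻¹) dμ(x)`. -/
noncomputable def translateMeasure (μ : RadonDual G) (g : G) : RadonDual G :=
  μ.comp (rightTranslateCLM g⁻¹)

/-- The right orbit `μ_G` of a measure. -/
def rightOrbit (μ : RadonDual G) : Set (RadonDual G) :=
  Set.range fun g : G => translateMeasure μ g

/-- The function `f · μ`, that is `y ↦ ∫ f (x y) dμ(x)`. -/
noncomputable def funDotMeasure (f : C(G, ℂ)) (μ : RadonDual G) : G → ℂ :=
  fun y => μ (rightTranslateFun y f)

variable (G)

/-- `M_c(G)`: the measures `μ` such that `f · μ` is continuous for every continuous `f`. -/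
def measureMc : Set (RadonDual G) :=
  {μ | ∀ f : C(G, ℂ), Continuous (funDotMeasure f μ)}

/-- `L^c(G)`: the measures `μ` in `M_c(G)` for which `x ↦ μ_{x⁻¹}` is norm continuous from `G`
to `M(G)`. -/
def measureLc : Set (RadonDual G) :=
  {μ | μ ∈ measureMc G ∧ Continuous fun x : G => translateMeasure μ x⁻¹}

/-- `M_w(G)`: the measures in `M_c(G)` whose right orbit is relatively compact in the weak
topology of the Banach space `M(G)`. -/
def measureMw : Set (RadonDual G) :=
  {μ | μ ∈ measureMc G ∧
    IsCompact (closure (toWeakSpace ℂ (RadonDual G) '' rightOrbit μ))}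

end Translation

/-! A Haar functional has constant orbit, and a norm-continuous image of the compact `G` is weakly
compact; the substance is 3 → 1. Dominate a nonzero `μ` in `M_w(G)` by a finite regular measure and
let `ν g` be its right translates. Were the `ν g` able to drift apart, a sequence of translates
would be carried by almost disjoint sets, and gluing test functions along it would violate the
interchange of limits that weak compactness of the orbit imposes. Hence every `ν j` shares mass at
least `ε` with one of finitely many `ν i` (`exists_uniform_overlap`).

The forms `B f (u, v) = ∑ uᵢ vⱼ ∫ f d(νᵢ ⊓ νⱼ)` are positive semidefinite for `f ≥ 0`
(`sum_mul_integral_inf_nonneg`) and covariant under right translation. By Cauchy–Schwarz, uniform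
overlap bounds `B 1` away from zero on the convex hull of the point masses. A sequence minimising `B
1` there is, by the parallelogram law, asymptotically indistinguishable from its translates, so `f ↦
lim B f (uₙ, uₙ)` is a nonzero positive invariant functional (`exists_invariant_functional`). Riesz
representation turns it into a Haar measure. -/

/-! ### Infima of measures as a positive semidefinite kernel. -/

section LatticeInfimum

open scoped NNReal ENNReal

variable {X : Type*} [MeasurableSpace X]

/-- The infimum of two measures with densities has the infimum of the densities as density. -/
theorem withDensity_inf_withDensity (τ : Measure X) {p q : X → ℝ≥0∞} (hp : Measurable p)
    (hq : Measurable q) :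
    τ.withDensity p ⊓ τ.withDensity q = τ.withDensity fun x => min (p x) (q x) := by
  refine le_antisymm (Measure.le_iff.2 fun s hs => ?_)
    (le_inf (withDensity_mono (.of_forall fun x => min_le_left _ _))
      (withDensity_mono (.of_forall fun x => min_le_right _ _)))
  have hA : MeasurableSet {x | p x ≤ q x} := measurableSet_le hp hq
  rw [← measure_inter_add_sdiff s hA, Set.sdiff_eq,
    ← measure_inter_add_sdiff (μ := τ.withDensity _) s hA, Set.sdiff_eq]
  refine add_le_add ?_ ?_
  · refine (Measure.le_iff'.1 inf_le_left _).trans ?_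
    rw [withDensity_apply _ (hs.inter hA), withDensity_apply _ (hs.inter hA)]
    exact setLIntegral_mono (hp.min hq) fun x hx => le_min le_rfl hx.2
  · refine (Measure.le_iff'.1 inf_le_right _).trans ?_
    rw [withDensity_apply _ (hs.inter hA.compl), withDensity_apply _ (hs.inter hA.compl)]
    exact setLIntegral_mono (hp.min hq) fun x hx => le_min (le_of_not_ge hx.2) le_rfl

/-- `min` is a positive semidefinite kernel on the non-negative reals. -/
theorem sum_mul_min_nonneg {ι : Type*} (s : Finset ι) (u : ι → ℝ) (p : ι → ℝ≥0) :
    0 ≤ ∑ i ∈ s, ∑ j ∈ s, u i * u j * ((min (p i) (p j) : ℝ≥0) : ℝ) := by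
  -- `min a b` is the length of `[0, a] ∩ [0, b]`, so the kernel is a Gram matrix of indicator
  -- functions.
  have h : (Matrix.of fun i j : s => volume.real
      (Set.Icc (0 : ℝ) (p i) ∩ Set.Icc (0 : ℝ) (p j))).PosSemidef :=
    posSemidef_matrix_measure_inter (fun _ => measurableSet_Icc)
      (fun _ => isCompact_Icc.measure_ne_top)
  have h' := h.dotProduct_mulVec_nonneg (fun i : s => u i)
  rw [← Finset.sum_coe_sort s]
  refine h'.trans_eq ?_
  simp only [dotProduct, Matrix.mulVec, Matrix.of_apply, Finset.mul_sum, Set.Icc_inter_Icc]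
  refine Finset.sum_congr rfl fun i _ => ?_
  rw [← Finset.sum_coe_sort s]
  refine Finset.sum_congr rfl fun j _ => ?_
  simp
  ring

/-- Finite measures of a finite family have finite densities with respect to their sum. -/
theorem exists_nnreal_density_sum {ι : Type*} (s : Finset ι) (ν : ι → Measure X)
    [∀ i, IsFiniteMeasure (ν i)] :
    ∃ p : ι → X → ℝ≥0, (∀ i, Measurable (p i)) ∧
      ∀ i ∈ s, ν i = (∑ j ∈ s, ν j).withDensity fun x => (p i x : ℝ≥0∞) := by
  refine ⟨fun i x => ((ν i).rnDeriv (∑ j ∈ s, ν j) x).toNNReal,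
    fun i => (Measure.measurable_rnDeriv _ _).ennreal_toNNReal, fun i hi => ?_⟩
  have hle : ν i ≤ ∑ j ∈ s, ν j := Finset.single_le_sum (f := ν) (fun _ _ => Measure.zero_le _) hi
  conv_lhs => rw [← Measure.withDensity_rnDeriv_eq (ν i) _ hle.absolutelyContinuous]
  refine withDensity_congr_ae ?_
  filter_upwards [Measure.rnDeriv_lt_top (ν i) (∑ j ∈ s, ν j)] with x hx
  rw [ENNReal.coe_toNNReal hx.ne]

theorem isFiniteMeasure_inf (ρ σ : Measure X) [IsFiniteMeasure ρ] : IsFiniteMeasure (ρ ⊓ σ) :=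
  isFiniteMeasure_of_le ρ inf_le_left

/-- The infimum of measures is a positive semidefinite kernel. -/
theorem sum_mul_integral_inf_nonneg {ι : Type*} (s : Finset ι) (ν : ι → Measure X)
    [∀ i, IsFiniteMeasure (ν i)] (u : ι → ℝ) {f : X → ℝ} (h0 : ∀ x, 0 ≤ f x)
    (hfi : ∀ i, Integrable f (ν i)) :
    0 ≤ ∑ i ∈ s, ∑ j ∈ s, u i * u j * ∫ x, f x ∂(ν i ⊓ ν j) := by
  obtain ⟨p, hp, hν⟩ := exists_nnreal_density_sum s ν
  set τ := ∑ j ∈ s, ν j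
  -- Common densities reduce the claim to the pointwise inequality for `min`, integrated against `f
  -- τ`.
  have key : ∀ i ∈ s, ∀ j ∈ s,
      ν i ⊓ ν j = τ.withDensity fun x => ((min (p i x) (p j x) : ℝ≥0) : ℝ≥0∞) := by
    intro i hi j hj
    conv_lhs => rw [hν i hi, hν j hj]
    rw [withDensity_inf_withDensity τ (hp i).coe_nnreal_ennreal (hp j).coe_nnreal_ennreal]
    simp only [ENNReal.coe_min]
  have hint : ∀ i ∈ s, ∀ j ∈ s,
      Integrable (fun x => u i * u j * (((min (p i x) (p j x) : ℝ≥0) : ℝ) * f x)) τ := by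
    intro i hi j hj
    refine Integrable.const_mul ?_ _
    have h1 : Integrable f (ν i ⊓ ν j) := (hfi i).mono_measure inf_le_left
    rw [key i hi j hj, integrable_withDensity_iff_integrable_smul ((hp i).min (hp j))] at h1
    exact h1
  have heq : ∑ i ∈ s, ∑ j ∈ s, u i * u j * ∫ x, f x ∂(ν i ⊓ ν j) =
      ∫ x, ∑ i ∈ s, ∑ j ∈ s, u i * u j * (((min (p i x) (p j x) : ℝ≥0) : ℝ) * f x) ∂τ := by
    rw [integral_finsetSum _ fun i hi => integrable_finsetSum _ fun j hj => hint i hi j hj]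
    refine Finset.sum_congr rfl fun i hi => ?_
    rw [integral_finsetSum _ fun j hj => hint i hi j hj]
    refine Finset.sum_congr rfl fun j hj => ?_
    rw [key i hi j hj, integral_withDensity_eq_integral_smul ((hp i).min (hp j)),
      integral_const_mul]
    rfl
  rw [heq]
  refine integral_nonneg fun x => ?_
  refine (mul_nonneg (sum_mul_min_nonneg s u fun i => p i x) (h0 x)).trans_eq ?_
  simp only [Finset.sum_mul, mul_assoc]

theorem map_inf_measurableEquiv (e : X ≃ᵐ X) (ρ σ : Measure X) :
    (ρ ⊓ σ).map e = ρ.map e ⊓ σ.map e := by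
  refine le_antisymm (le_inf (Measure.map_mono inf_le_left e.measurable)
    (Measure.map_mono inf_le_right e.measurable)) ?_
  have h : (ρ.map e ⊓ σ.map e).map e.symm ≤ ρ ⊓ σ := by
    refine le_inf ?_ ?_
    · refine (Measure.map_mono inf_le_left e.symm.measurable).trans_eq ?_
      simp
    · refine (Measure.map_mono inf_le_right e.symm.measurable).trans_eq ?_
      simp
  have := Measure.map_mono h e.measurable
  simpa using this

end LatticeInfimum

/-! ### Invariant functionals by minimising a quadratic form. -/

section Averaging

open Filter Topology

theorem add_norm_smul_one_nonneg {X : Type*} [TopologicalSpace X] [CompactSpace X]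
    (f : C(X, ℝ)) : 0 ≤ f + ‖f‖ • (1 : C(X, ℝ)) := fun x => by
  have := neg_le_of_abs_le (f.norm_coe_le_norm x)
  change (0 : ℝ) ≤ f x + ‖f‖ * 1
  linarith

/-- An invariant positive functional from a covariant family of positive semidefinite forms:
if `B 1` is bounded below on an invariant convex set, the forms `B f` have a limit along a
sequence in the set that minimises `B 1`, and this limit does not see the group action. -/
theorem exists_invariant_functional {X V ι : Type*} [TopologicalSpace X] [CompactSpace X]
    [AddCommGroup V] [Module ℝ V]
    (B : C(X, ℝ) →ₗ[ℝ] V →ₗ[ℝ] V →ₗ[ℝ] ℝ)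
    (hsymm : ∀ f u v, B f u v = B f v u) (hpos : ∀ f, 0 ≤ f → ∀ u, 0 ≤ B f u u)
    (C : Set V) (hC : Convex ℝ C) (hne : C.Nonempty) (c : ℝ) (hc : 0 < c)
    (hcB : ∀ u ∈ C, c ≤ B 1 u u)
    (L : ι → V → V) (τ : ι → C(X, ℝ) →ₗ[ℝ] C(X, ℝ)) (hL : ∀ t, ∀ u ∈ C, L t u ∈ C)
    (hτ : ∀ t, τ t 1 = 1) (hB : ∀ t f u, B (τ t f) u u = B f (L t u) (L t u)) :
    ∃ m : C(X, ℝ) →ₗ[ℝ] ℝ, (∀ f, 0 ≤ f → 0 ≤ m f) ∧ 0 < m 1 ∧ ∀ t f, m (τ t f) = m f := by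
  set S : Set ℝ := (fun u => B 1 u u) '' C
  have hSb : BddBelow S := ⟨c, by rintro _ ⟨u, hu, rfl⟩; exact hcB u hu⟩
  set d := sInf S
  have hdle : ∀ u ∈ C, d ≤ B 1 u u := fun u hu => csInf_le hSb ⟨u, hu, rfl⟩
  have hcd : c ≤ d := le_csInf (hne.image _) (by rintro _ ⟨u, hu, rfl⟩; exact hcB u hu)
  have hex : ∀ n : ℕ, ∃ u ∈ C, B 1 u u < d + 1 / ((n : ℝ) + 1) := by
    intro n
    obtain ⟨_, ⟨u, hu, rfl⟩, hlt⟩ := exists_lt_of_csInf_lt (hne.image _)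
      (show sInf S < d + 1 / ((n : ℝ) + 1) from lt_add_of_pos_right _ Nat.one_div_pos_of_nat)
    exact ⟨u, hu, hlt⟩
  choose u huC hu using hex
  have hu1 : ∀ n, B 1 (u n) (u n) ≤ d + 1 := fun n => (hu n).le.trans <| by
    have : 1 / ((n : ℝ) + 1) ≤ 1 := by
      rw [div_le_one (by positivity)]; linarith [(Nat.cast_nonneg n : (0 : ℝ) ≤ n)]
    linarith
  have hbound : ∀ f v, |B f v v| ≤ ‖f‖ * B 1 v v := by
    intro f v
    have h1 : 0 ≤ B (‖f‖ • 1 - f) v v := hpos _ (fun x => by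
      simpa using (le_abs_self _).trans (f.norm_coe_le_norm x)) v
    have h2 : 0 ≤ B (‖f‖ • 1 + f) v v := hpos _ (add_comm f _ ▸ add_norm_smul_one_nonneg f) v
    simp only [map_sub, map_add, map_smul, LinearMap.sub_apply, LinearMap.add_apply,
      LinearMap.smul_apply, smul_eq_mul] at h1 h2
    exact abs_le.2 ⟨by linarith, by linarith⟩
  -- One ultrafilter serves all `f` at once, which makes the limit linear in `f`.
  set 𝓤 : Ultrafilter ℕ := hyperfilter ℕ
  have hlim : ∀ f, ∃ a, Tendsto (fun n => B f (u n) (u n)) 𝓤 (𝓝 a) := by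
    intro f
    have hK : IsCompact (Set.Icc (-(‖f‖ * (d + 1))) (‖f‖ * (d + 1))) := isCompact_Icc
    obtain ⟨a, -, ha⟩ := hK.ultrafilter_le_nhds (𝓤.map fun n : ℕ => B f (u n) (u n)) (by
      rw [Ultrafilter.coe_map, le_principal_iff]
      refine mem_map.2 (univ_mem' fun n => abs_le.1 ((hbound f (u n)).trans
        (mul_le_mul_of_nonneg_left (hu1 n) (norm_nonneg f)))))
    exact ⟨a, ha⟩
  choose m hm using hlim
  have hsmall : Tendsto (fun n : ℕ => 4 * (1 / ((n : ℝ) + 1))) 𝓤 (𝓝 0) := by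
    have h := (tendsto_one_div_add_atTop_nhds_zero_nat (𝕜 := ℝ)).const_mul 4
    rw [mul_zero] at h
    exact h.mono_left (Nat.hyperfilter_le_atTop)
  let M : C(X, ℝ) →ₗ[ℝ] ℝ :=
    { toFun := m
      map_add' := fun f g => tendsto_nhds_unique (hm (f + g)) (by
        simpa using (hm f).add (hm g))
      map_smul' := fun r f => tendsto_nhds_unique (hm (r • f)) (by
        simpa using (hm f).const_mul r) }
  have hMpos : ∀ f, 0 ≤ f → ∀ t, M (τ t f) = M f := by
    intro f hf t
    set v := fun n => L t (u n) with hv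
    have hvC : ∀ n, v n ∈ C := fun n => hL t _ (huC n)
    have hv1 : ∀ n, B 1 (v n) (v n) = B 1 (u n) (u n) := fun n => by rw [← hB, hτ]
    -- The midpoint of `u n` and `v n` lies in `C`; doubling it gives the factor 4.
    have hsum : ∀ n, 4 * d ≤ B 1 (u n + v n) (u n + v n) := by
      intro n
      have := hdle _ (hC (huC n) (hvC n) (by norm_num : (0 : ℝ) ≤ 1 / 2)
        (by norm_num : (0 : ℝ) ≤ 1 / 2) (by norm_num))
      rw [← smul_add] at this
      simp only [map_smul, LinearMap.smul_apply, smul_eq_mul] at this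
      linarith
    have hpar : ∀ n, B 1 (u n - v n) (u n - v n) + B 1 (u n + v n) (u n + v n) =
        4 * B 1 (u n) (u n) := by
      intro n
      have := hv1 n
      simp only [map_sub, map_add, LinearMap.sub_apply, LinearMap.add_apply]
      linarith
    have h1pos : (0 : C(X, ℝ)) ≤ 1 := fun x => zero_le_one
    have hdiff : ∀ n, B 1 (u n - v n) (u n - v n) ≤ 4 * (1 / ((n : ℝ) + 1)) := fun n => by
      linarith [hsum n, hpar n, hu n]
    have hadd : ∀ n, B 1 (u n + v n) (u n + v n) ≤ 4 * (d + 1) := fun n => by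
      linarith [hpos 1 h1pos (u n - v n), hpar n, hu1 n]
    -- By symmetry the difference is `B f (u - v, u + v)`; Cauchy–Schwarz applies, and `B 1` of `u -
    -- v` tends to zero.
    have hcs : ∀ n, (B f (u n) (u n) - B f (v n) (v n)) ^ 2 ≤
        4 * (1 / ((n : ℝ) + 1)) * (‖f‖ * (‖f‖ * (4 * (d + 1)))) := by
      intro n
      have h := LinearMap.BilinForm.apply_sq_le_of_symm (B f) (hpos f hf)
        ⟨fun x y => hsymm f x y⟩ (u n - v n) (u n + v n)
      have e : B f (u n - v n) (u n + v n) = B f (u n) (u n) - B f (v n) (v n) := by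
        simp only [map_sub, map_add, LinearMap.sub_apply]
        linarith [hsymm f (u n) (v n)]
      rw [e] at h
      refine h.trans ?_
      have b1 := (le_abs_self _).trans (hbound f (u n - v n))
      have b2 := (le_abs_self _).trans (hbound f (u n + v n))
      have := mul_le_mul (b1.trans (mul_le_mul_of_nonneg_left (hdiff n) (norm_nonneg f)))
        (b2.trans (mul_le_mul_of_nonneg_left (hadd n) (norm_nonneg f))) (hpos f hf _)
        (by positivity)
      linarith
    have hl1 : Tendsto (fun n => (B f (u n) (u n) - B f (v n) (v n)) ^ 2) 𝓤
        (𝓝 ((m f - m (τ t f)) ^ 2)) := by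
      refine ((hm f).sub ?_).pow 2
      simpa only [hB] using hm (τ t f)
    have hl2 : Tendsto (fun n => (B f (u n) (u n) - B f (v n) (v n)) ^ 2) 𝓤 (𝓝 0) :=
      squeeze_zero (fun n => sq_nonneg _) hcs (by simpa using hsmall.mul_const _)
    have := tendsto_nhds_unique hl1 hl2
    exact (sub_eq_zero.1 (pow_eq_zero_iff two_ne_zero |>.1 this)).symm
  refine ⟨M, fun f hf => ge_of_tendsto' (hm f) fun n => hpos f hf _,
    hc.trans_le (hcd.trans (ge_of_tendsto' (hm 1) fun n => hdle _ (huC n))), fun t f => ?_⟩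
  -- Adding a constant, which `τ t` fixes, reduces to `f ≥ 0`.
  have := hMpos _ (add_norm_smul_one_nonneg f) t
  simpa only [map_add, map_smul, hτ, add_left_inj] using this

end Averaging

/-! ### Domination of a functional by a regular measure. -/

section TotalVariation

open scoped NNReal

variable {X : Type*} [TopologicalSpace X]

/-- The values `‖μ g‖` for `g` dominated by `f`; their supremum is the total variation of `μ`
evaluated at `f`. -/
def dominatedValues (μ : StrongDual ℂ C(X, ℂ)) (f : X → ℝ≥0) : Set ℝ :=
  {r | ∃ g : C(X, ℂ), (∀ x, ‖g x‖ ≤ f x) ∧ r = ‖μ g‖}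

/-- The total variation of `μ`, as a function on non-negative functions. -/
noncomputable def totalVariation (μ : StrongDual ℂ C(X, ℂ)) (f : X → ℝ≥0) : ℝ :=
  sSup (dominatedValues μ f)

theorem dominatedValues_nonempty (μ : StrongDual ℂ C(X, ℂ)) (f : X → ℝ≥0) : (dominatedValues μ f).Nonempty :=
  ⟨_, 0, fun x => by simp, rfl⟩

variable [CompactSpace X] (μ : StrongDual ℂ C(X, ℂ))

theorem bddAbove_dominatedValues {f : X → ℝ≥0} (hf : Continuous f) :
    BddAbove (dominatedValues μ f) := by
  let F : C(X, ℝ) := ⟨fun x => (f x : ℝ), by fun_prop⟩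
  refine ⟨‖μ‖ * ‖F‖, ?_⟩
  rintro _ ⟨g, hg, rfl⟩
  refine (μ.le_opNorm g).trans (mul_le_mul_of_nonneg_left ?_ (norm_nonneg _))
  exact (ContinuousMap.norm_le _ (norm_nonneg F)).2 fun x =>
    ((hg x).trans (le_abs_self _)).trans (F.norm_coe_le_norm x)

theorem norm_le_totalVariation {f : X → ℝ≥0} (hf : Continuous f) {g : C(X, ℂ)}
    (hg : ∀ x, ‖g x‖ ≤ f x) : ‖μ g‖ ≤ totalVariation μ f :=
  le_csSup (bddAbove_dominatedValues μ hf) ⟨g, hg, rfl⟩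

theorem totalVariation_nonneg {f : X → ℝ≥0} (hf : Continuous f) : 0 ≤ totalVariation μ f :=
  (norm_nonneg _).trans (norm_le_totalVariation μ hf (g := 0) fun x => by simp)

theorem mul_totalVariation_le (c : ℝ≥0) {f : X → ℝ≥0} (hf : Continuous f) :
    c * totalVariation μ f ≤ totalVariation μ (c • f) := by
  rcases eq_or_ne c 0 with rfl | hc
  · simpa using totalVariation_nonneg μ (f := (0 : ℝ≥0) • f) (by fun_prop)
  have hc' : (0 : ℝ) < c := by positivity
  rw [mul_comm, ← le_div_iff₀ hc']
  refine csSup_le (dominatedValues_nonempty μ f) ?_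
  rintro _ ⟨g, hg, rfl⟩
  rw [le_div_iff₀ hc', mul_comm]
  have := norm_le_totalVariation μ (f := c • f) (by fun_prop) (g := ((c : ℝ) : ℂ) • g) fun x => by
    simpa using mul_le_mul_of_nonneg_left (hg x) hc'.le
  simpa using this

theorem totalVariation_smul (c : ℝ≥0) {f : X → ℝ≥0} (hf : Continuous f) :
    totalVariation μ (c • f) = c * totalVariation μ f := by
  refine le_antisymm ?_ (mul_totalVariation_le μ c hf)
  rcases eq_or_ne c 0 with rfl | hc
  · refine csSup_le (dominatedValues_nonempty μ _) ?_
    rintro _ ⟨g, hg, rfl⟩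
    have : g = 0 := by ext x; simpa using hg x
    simp [this]
  have hc' : (0 : ℝ) < c := by positivity
  have := mul_totalVariation_le μ c⁻¹ (f := c • f) (by fun_prop)
  rw [inv_smul_smul₀ hc, NNReal.coe_inv, inv_mul_le_iff₀ hc'] at this
  exact this

/-- For `≤`, split `g` in proportion to `f₁`, `f₂` and a constant `δ > 0` that keeps the denominator
positive; the `δ` piece costs at most `‖μ‖ δ`. For `≥`, rotate the phases of near-optimal `g₁`, `g₂`
so that their values add up. -/
theorem totalVariation_add {f₁ f₂ : X → ℝ≥0} (h₁ : Continuous f₁) (h₂ : Continuous f₂) :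
    totalVariation μ (f₁ + f₂) = totalVariation μ f₁ + totalVariation μ f₂ := by
  refine le_antisymm ?_ ?_
  · refine csSup_le (dominatedValues_nonempty μ _) ?_
    rintro _ ⟨g, hg, rfl⟩
    have key : ∀ δ : ℝ, 0 < δ →
        ‖μ g‖ ≤ totalVariation μ f₁ + totalVariation μ f₂ + ‖μ‖ * δ := by
      intro δ hδ
      have hpos : ∀ x, 0 < (f₁ x : ℝ) + f₂ x + δ := fun x => by positivity
      let w : (X → ℝ) → X → ℂ := fun p x => g x * ((p x / (f₁ x + f₂ x + δ) : ℝ) : ℂ)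
      have hw : ∀ p : X → ℝ, Continuous p → Continuous (w p) := fun p hp =>
        g.continuous.mul (Complex.continuous_ofReal.comp
          (hp.div (by fun_prop) fun x => (hpos x).ne'))
      have hwn : ∀ p : X → ℝ, (∀ x, 0 ≤ p x) → ∀ x, ‖w p x‖ ≤ p x := by
        intro p hp x
        have hgx : ‖g x‖ ≤ f₁ x + f₂ x + δ := by
          have : ‖g x‖ ≤ f₁ x + f₂ x := by simpa using hg x
          linarith
        simp only [w, norm_mul, Complex.norm_real, Real.norm_eq_abs,
          abs_of_nonneg (div_nonneg (hp x) (hpos x).le)]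
        rw [mul_div_assoc', div_le_iff₀ (hpos x), mul_comm]
        exact mul_le_mul_of_nonneg_left hgx (hp x)
      let g₁ : C(X, ℂ) := ⟨w fun x => f₁ x, hw _ (by fun_prop)⟩
      let g₂ : C(X, ℂ) := ⟨w fun x => f₂ x, hw _ (by fun_prop)⟩
      let g₃ : C(X, ℂ) := ⟨w fun _ => δ, hw _ (by fun_prop)⟩
      have hsum : g = g₁ + g₂ + g₃ := by
        ext x
        have := (hpos x).ne'
        change g x = w (fun x => f₁ x) x + w (fun x => f₂ x) x + w (fun _ => δ) x
        simp only [w, ← mul_add, ← Complex.ofReal_add, ← add_div, div_self this,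
          Complex.ofReal_one, mul_one]
      have e₁ := norm_le_totalVariation μ h₁ (g := g₁) (hwn _ fun x => (f₁ x).2)
      have e₂ := norm_le_totalVariation μ h₂ (g := g₂) (hwn _ fun x => (f₂ x).2)
      have e₃ : ‖μ g₃‖ ≤ ‖μ‖ * δ := (μ.le_opNorm g₃).trans
        (mul_le_mul_of_nonneg_left
          ((ContinuousMap.norm_le _ hδ.le).2 (hwn _ fun _ => hδ.le)) (norm_nonneg _))
      calc ‖μ g‖ = ‖μ g₁ + μ g₂ + μ g₃‖ := by rw [← map_add, ← map_add, ← hsum]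
        _ ≤ ‖μ g₁‖ + ‖μ g₂‖ + ‖μ g₃‖ := norm_add₃_le
        _ ≤ _ := by linarith
    refine le_of_forall_pos_le_add fun ε hε => ?_
    have hμ : 0 < ‖μ‖ + 1 := by positivity
    refine (key (ε / (‖μ‖ + 1)) (by positivity)).trans (add_le_add_right ?_ _)
    rw [mul_div_assoc', div_le_iff₀ hμ]
    nlinarith [norm_nonneg μ]
  · rw [← le_sub_iff_add_le]
    refine csSup_le (dominatedValues_nonempty μ _) ?_
    rintro _ ⟨g₁, hg₁, rfl⟩
    rw [le_sub_iff_add_le, ← le_sub_iff_add_le']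
    refine csSup_le (dominatedValues_nonempty μ _) ?_
    rintro _ ⟨g₂, hg₂, rfl⟩
    rw [le_sub_iff_add_le']
    have phase : ∀ z : ℂ, ∃ a : ℂ, ‖a‖ = 1 ∧ ((‖z‖ : ℝ) : ℂ) = a * z :=
      RCLike.exists_norm_eq_mul_self
    obtain ⟨a₁, ha₁, e₁⟩ := phase (μ g₁)
    obtain ⟨a₂, ha₂, e₂⟩ := phase (μ g₂)
    have := norm_le_totalVariation μ (f := f₁ + f₂) (by fun_prop) (g := a₁ • g₁ + a₂ • g₂)
      fun x => by
        refine (norm_add_le _ _).trans ?_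
        simpa [ha₁, ha₂] using add_le_add (hg₁ x) (hg₂ x)
    rw [map_add, map_smul, map_smul, smul_eq_mul, smul_eq_mul, ← e₁, ← e₂] at this
    rwa [← Complex.ofReal_add, Complex.norm_of_nonneg (by positivity)] at this

/-- A bounded functional on `C(X, ℂ)` is dominated by a finite regular measure. -/
theorem exists_regular_measure_dominating [T2Space X] [MeasurableSpace X] [BorelSpace X] :
    ∃ ν : Measure X, ν.Regular ∧ IsFiniteMeasure ν ∧ ∀ g : C(X, ℂ), ‖μ g‖ ≤ ∫ x, ‖g x‖ ∂ν := by
  let Λ : CompactlySupportedContinuousMap X ℝ≥0 →ₗ[ℝ≥0] ℝ≥0 :=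
    { toFun := fun f => ⟨totalVariation μ f, totalVariation_nonneg μ f.continuous⟩
      map_add' := fun f g => NNReal.eq (totalVariation_add μ f.continuous g.continuous)
      map_smul' := fun c f => NNReal.eq (totalVariation_smul μ c f.continuous) }
  have hreg : (NNRealRMK.rieszMeasure Λ).Regular := NNRealRMK.rieszMeasure_regular Λ
  refine ⟨NNRealRMK.rieszMeasure Λ, hreg, inferInstance, fun g => ?_⟩
  let f : CompactlySupportedContinuousMap X ℝ≥0 :=
    ⟨⟨fun x => ‖g x‖₊, by fun_prop⟩, HasCompactSupport.of_compactSpace _⟩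
  have := NNRealRMK.integral_rieszMeasure Λ f
  refine (norm_le_totalVariation μ f.continuous fun x => le_rfl).trans_eq this.symm

end TotalVariation

/-! ### Weak compactness and almost disjoint sequences. -/

section WeakCompactness

open Filter Topology

/-- A bounded sequence in a normed space has a weak-* limit in the bidual along an ultrafilter. -/
theorem exists_bidual_limit {E : Type*} [NormedAddCommGroup E] [NormedSpace ℂ E]
    (𝓤 : Ultrafilter ℕ) (l : ℕ → StrongDual ℂ E) (hl : ∀ n, ‖l n‖ ≤ 1) :
    ∃ L : StrongDual ℂ E, ‖L‖ ≤ 1 ∧ ∀ x, Tendsto (fun n => l n x) 𝓤 (𝓝 (L x)) := by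
  obtain ⟨L, hL, hlim⟩ := (WeakDual.isCompact_closedBall (𝕜 := ℂ) (0 : StrongDual ℂ E)
    1).ultrafilter_le_nhds (𝓤.map fun n => StrongDual.toWeakDual (l n)) (by
      rw [Ultrafilter.coe_map, le_principal_iff]
      refine mem_map.2 (univ_mem' fun n => ?_)
      simpa using hl n)
  refine ⟨WeakDual.toStrongDual L, by simpa using hL, fun x => ?_⟩
  exact ((WeakDual.eval_continuous x).tendsto L).comp hlim

/-- Interchange of limits for functionals in a relatively weakly compact set. -/
theorem norm_le_of_isCompact_closure_weak {E : Type*} [NormedAddCommGroup E] [NormedSpace ℂ E]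
    (μ : ℕ → StrongDual ℂ E) (K : Set (WeakSpace ℂ (StrongDual ℂ E))) (hK : IsCompact K)
    (hμ : ∀ n, toWeakSpace ℂ (StrongDual ℂ E) (μ n) ∈ K) (φ : ℕ → ℕ → E)
    (hφ : ∀ N k, ‖φ N k‖ ≤ 1) {a b : ℝ} {c : ℂ} (ha : ∀ N i, i < N → ∀ k, ‖μ i (φ N k)‖ ≤ a)
    (hb : ∀ N i, N ≤ i → ∀ᶠ k in atTop, ‖μ i (φ N k) - c‖ ≤ b) : ‖c‖ ≤ a + b := by
  set 𝓤 : Ultrafilter ℕ := hyperfilter ℕ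
  have h𝓤 : (𝓤 : Filter ℕ) ≤ atTop := Nat.hyperfilter_le_atTop
  obtain ⟨ρ, -, hρ⟩ := hK.ultrafilter_le_nhds
    (𝓤.map fun n => toWeakSpace ℂ (StrongDual ℂ E) (μ n)) (by
      rw [Ultrafilter.coe_map, le_principal_iff]
      exact mem_map.2 (univ_mem' hμ))
  let r : StrongDual ℂ E := (toWeakSpace ℂ (StrongDual ℂ E)).symm ρ
  have hlim : ∀ l : StrongDual ℂ (StrongDual ℂ E), Tendsto (fun n => l (μ n)) 𝓤 (𝓝 (l r)) :=
    fun l => ((WeakBilin.eval_continuous (topDualPairing ℂ (StrongDual ℂ E)).flip l).tendsto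
      ρ).comp hρ
  have h1 : ∀ N, ∃ L : StrongDual ℂ (StrongDual ℂ E), ‖L‖ ≤ 1 ∧
      ∀ σ, Tendsto (fun k => σ (φ N k)) 𝓤 (𝓝 (L σ)) := fun N =>
    exists_bidual_limit 𝓤 (fun k => NormedSpace.inclusionInDoubleDual ℂ E (φ N k)) fun k =>
      (NormedSpace.double_dual_bound ℂ E _).trans (hφ N k)
  choose l hl1 hl using h1
  obtain ⟨L, -, hL⟩ := exists_bidual_limit 𝓤 l hl1
  have hla : ∀ N i, i < N → ‖l N (μ i)‖ ≤ a := fun N i hi =>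
    le_of_tendsto (hl N (μ i)).norm (univ_mem' fun k => ha N i hi k)
  have hlb : ∀ N i, N ≤ i → ‖l N (μ i) - c‖ ≤ b := fun N i hi =>
    le_of_tendsto ((hl N (μ i)).sub_const c).norm (h𝓤 (hb N i hi))
  -- Letting `i`, then `N`, tend to the limit puts `L r` within `b` of `c`; the opposite order below
  -- gives `‖L r‖ ≤ a`.
  have hrb : ∀ N, ‖l N r - c‖ ≤ b := fun N =>
    le_of_tendsto ((hlim (l N)).sub_const c).norm
      (h𝓤 ((eventually_ge_atTop N).mono fun i hi => hlb N i hi))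
  have hLb : ‖L r - c‖ ≤ b := le_of_tendsto ((hL r).sub_const c).norm (univ_mem' hrb)
  have hLa : ∀ i, ‖L (μ i)‖ ≤ a := fun i =>
    le_of_tendsto (hL (μ i)).norm (h𝓤 ((eventually_gt_atTop i).mono fun N hN => hla N i hN))
  have hra : ‖L r‖ ≤ a := le_of_tendsto (hlim L).norm (univ_mem' hLa)
  calc ‖c‖ = ‖L r - (L r - c)‖ := by rw [sub_sub_cancel]
    _ ≤ _ := (norm_sub_le _ _).trans (add_le_add hra hLb)

variable {X : Type*} [TopologicalSpace X]

/-- The functions obtained from `0` by successively replacing the current function by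
`f n` on the part of `X` cut out by `χ n`, for `n = N, N + 1, …`. -/
noncomputable def gluedFun (χ : ℕ → C(X, ℝ)) (f : ℕ → C(X, ℂ)) (N : ℕ) : ℕ → C(X, ℂ)
  | 0 => 0
  | k + 1 => ⟨fun x => (1 - χ (N + k) x : ℝ) * gluedFun χ f N k x + (χ (N + k) x : ℝ) * f (N + k) x,
      by fun_prop⟩

theorem norm_gluedFun_apply_le {χ : ℕ → C(X, ℝ)} {f : ℕ → C(X, ℂ)}
    (hχ : ∀ n x, χ n x ∈ Set.Icc (0 : ℝ) 1) (hf : ∀ n x, ‖f n x‖ ≤ 1) (N k : ℕ) (x : X) :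
    ‖gluedFun χ f N k x‖ ≤ 1 := by
  induction k with
  | zero => simp [gluedFun]
  | succ k ih =>
    obtain ⟨h0, h1⟩ := hχ (N + k) x
    refine (norm_add_le _ _).trans ?_
    rw [norm_mul, norm_mul, Complex.norm_of_nonneg h0, Complex.norm_of_nonneg (sub_nonneg.2 h1)]
    nlinarith [hf (N + k) x]

variable [CompactSpace X] [MeasurableSpace X] [BorelSpace X]

theorem norm_apply_le_two_mul_integral {μ : StrongDual ℂ C(X, ℂ)} {ν : Measure X}
    [IsFiniteMeasure ν] (hμν : ∀ g : C(X, ℂ), ‖μ g‖ ≤ ∫ x, ‖g x‖ ∂ν) (χ : C(X, ℝ))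
    (g : C(X, ℂ)) (hg : ∀ x, ‖g x‖ ≤ 2 * χ x) :
    ‖μ g‖ ≤ 2 * ∫ x, χ x ∂ν := by
  refine (hμν g).trans ?_
  rw [← integral_const_mul]
  exact integral_mono_of_nonneg (.of_forall fun x => norm_nonneg _)
    ((χ.continuous.integrable_of_hasCompactSupport (.of_compactSpace _)).const_mul 2)
    (.of_forall hg)

/-- A sequence of functionals carried by almost disjoint parts of `X` is not relatively
weakly compact, unless it tends to zero in a suitable sense. -/
theorem norm_le_of_almost_disjoint (μ : ℕ → StrongDual ℂ C(X, ℂ)) (ν : ℕ → Measure X)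
    [∀ n, IsFiniteMeasure (ν n)] (hμν : ∀ n (g : C(X, ℂ)), ‖μ n g‖ ≤ ∫ x, ‖g x‖ ∂(ν n))
    (K : Set (WeakSpace ℂ (StrongDual ℂ C(X, ℂ)))) (hK : IsCompact K)
    (hμ : ∀ n, toWeakSpace ℂ (StrongDual ℂ C(X, ℂ)) (μ n) ∈ K)
    (f : ℕ → C(X, ℂ)) (hf : ∀ n x, ‖f n x‖ ≤ 1) (c : ℂ) (hc : ∀ n, μ n (f n) = c)
    (χ : ℕ → C(X, ℝ)) (hχ : ∀ n x, χ n x ∈ Set.Icc (0 : ℝ) 1) (δ : ℝ) (hδ : 0 ≤ δ)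
    (hχ0 : ∀ i n, i < n → ∫ x, χ n x ∂(ν i) ≤ δ * (1 / 2) ^ n)
    (hχ1 : ∀ n, ∫ x, (1 - χ n x) ∂(ν n) ≤ δ) : ‖c‖ ≤ 10 * δ := by
  set φ := gluedFun χ f
  have hφ : ∀ N k x, ‖φ N k x‖ ≤ 1 := norm_gluedFun_apply_le hχ hf
  have hfφ : ∀ n N k x, ‖f n x - φ N k x‖ ≤ 2 := fun n N k x =>
    (norm_sub_le _ _).trans (by linarith [hf n x, hφ N k x])
  -- Replacement number `n > i` changes the value of `μ i` by at most `2δ / 2 ^ n`; the bound is the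
  -- sum of this geometric series.
  have hdrift : ∀ i N k l, i < N + k → ‖μ i (φ N (k + l)) - μ i (φ N k)‖ ≤
      4 * δ * ((1 / 2) ^ (N + k) - (1 / 2) ^ (N + k + l)) := by
    intro i N k l hi
    induction l with
    | zero => simp
    | succ l ih =>
      have hstep : ‖μ i (φ N (k + l + 1) - φ N (k + l))‖ ≤ 2 * (δ * (1 / 2) ^ (N + (k + l))) := by
        refine (norm_apply_le_two_mul_integral (hμν i) (χ (N + (k + l)))
          _ fun x => ?_).trans (mul_le_mul_of_nonneg_left (hχ0 _ _ (by omega)) zero_le_two)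
        have e : (φ N (k + l + 1) - φ N (k + l)) x =
            (χ (N + (k + l)) x : ℝ) * (f (N + (k + l)) x - φ N (k + l) x) := by
          change ((1 - χ (N + (k + l)) x : ℝ) : ℂ) * φ N (k + l) x +
            (χ (N + (k + l)) x : ℝ) * f (N + (k + l)) x - φ N (k + l) x = _
          push_cast
          ring
        rw [e, norm_mul, Complex.norm_of_nonneg (hχ _ x).1, mul_comm]
        exact mul_le_mul_of_nonneg_right (hfφ _ _ _ _) (hχ _ x).1
      rw [map_sub] at hstep
      calc _ ≤ _ := norm_sub_le_norm_sub_add_norm_sub _ (μ i (φ N (k + l))) _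
        _ ≤ _ := add_le_add hstep ih
        _ = _ := by rw [← add_assoc N k l, ← add_assoc (N + k) l 1, pow_succ]; ring
  have hdrift' : ∀ i N k l, i < N + k → ‖μ i (φ N (k + l)) - μ i (φ N k)‖ ≤ 4 * δ := by
    intro i N k l hi
    refine (hdrift i N k l hi).trans ?_
    have h1 : ((1 : ℝ) / 2) ^ (N + k) ≤ 1 := pow_le_one₀ (by norm_num) (by norm_num)
    have h2 : (0 : ℝ) ≤ (1 / 2) ^ (N + k + l) := by positivity
    nlinarith
  -- Just after `f i` is glued in, the function differs from `f i` only through the factor `1 - χ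
  -- i`, of small `ν i`-integral.
  have hstart : ∀ i N k, N + k = i → ‖μ i (φ N (k + 1)) - c‖ ≤ 2 * δ := by
    rintro i N k rfl
    rw [← hc (N + k), ← map_sub]
    let χ' : C(X, ℝ) := 1 - χ (N + k)
    refine (norm_apply_le_two_mul_integral (hμν _) χ' _ fun x => ?_).trans (mul_le_mul_of_nonneg_left (hχ1 _) zero_le_two)
    have e : (φ N (k + 1) - f (N + k)) x =
        -((1 - χ (N + k) x : ℝ) * (f (N + k) x - φ N k x)) := by
      change ((1 - χ (N + k) x : ℝ) : ℂ) * φ N k x +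
        (χ (N + k) x : ℝ) * f (N + k) x - f (N + k) x = _
      push_cast
      ring
    rw [e, norm_neg, norm_mul, Complex.norm_of_nonneg (sub_nonneg.2 (hχ _ x).2), mul_comm]
    exact mul_le_mul_of_nonneg_right (hfφ _ _ _ _) (sub_nonneg.2 (hχ _ x).2)
  -- For `i < N` only drift from `φ N 0 = 0` occurs, so `a = 4δ`; for `i ≥ N`, drift after gluing `f
  -- i` adds to the starting error, so `b = 4δ + 2δ`.
  have := norm_le_of_isCompact_closure_weak μ K hK hμ φ
    (fun N k => (ContinuousMap.norm_le _ zero_le_one).2 (hφ N k)) (a := 4 * δ) (b := 6 * δ) (c := c)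
    (fun N i hi k => by
      have h := hdrift' i N 0 k (by simpa using hi)
      have h0 : φ N 0 = 0 := rfl
      simpa [h0] using h)
    (fun N i hi => by
      obtain ⟨j, rfl⟩ := Nat.exists_eq_add_of_le hi
      filter_upwards [eventually_ge_atTop (j + 1)] with k hk
      obtain ⟨l, rfl⟩ := Nat.exists_eq_add_of_le hk
      have h1 := hdrift' (N + j) N (j + 1) l (by omega)
      have h2 := hstart (N + j) N j rfl
      calc _ ≤ _ := norm_sub_le_norm_sub_add_norm_sub _ (μ (N + j) (φ N (j + 1))) _
        _ ≤ _ := add_le_add h1 h2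
        _ = _ := by ring)
  linarith

end WeakCompactness

/-! ### Uniform overlap in weakly compact families. -/

section UniformOverlap

variable {X : Type*} [TopologicalSpace X] [MeasurableSpace X]

/-- Measures with small infimum are separated by open sets. -/
theorem exists_open_cover_of_inf_lt (ρ σ : Measure X) [ρ.OuterRegular] [σ.OuterRegular] {ε : ℝ}
    (h : (ρ ⊓ σ) Set.univ < ENNReal.ofReal ε) :
    ∃ U V : Set X, IsOpen U ∧ IsOpen V ∧ U ∪ V = Set.univ ∧ ρ U ≤ ENNReal.ofReal ε ∧
      σ V ≤ ENNReal.ofReal ε := by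
  -- The infimum's mass is the infimum of `ρ t + σ tᶜ` over sets `t`; enlarge a good `t` and its
  -- complement to open sets.
  rw [Measure.inf_apply MeasurableSet.univ] at h
  obtain ⟨_, ⟨t, rfl⟩, ht⟩ := sInf_lt_iff.1 h
  rw [Set.inter_univ, Set.inter_univ] at ht
  obtain ⟨U, hU, hUo, hU'⟩ := t.exists_isOpen_lt_of_lt _ (lt_of_le_of_lt le_self_add ht)
  obtain ⟨V, hV, hVo, hV'⟩ := tᶜ.exists_isOpen_lt_of_lt _ (lt_of_le_of_lt le_add_self ht)
  exact ⟨U, V, hUo, hVo, Set.eq_univ_of_subset (Set.union_subset_union hU hV)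
    (Set.union_compl_self t), hU'.le, hV'.le⟩

variable [CompactSpace X] [T2Space X]

/-- A measure with small infimum with finitely many others is separated from them by a
continuous function. -/
theorem exists_continuous_separating {ι : Type*} (F : Finset ι) (ν : ι → Measure X)
    [∀ i, (ν i).OuterRegular] [∀ i, IsFiniteMeasure (ν i)] (σ : Measure X) [σ.OuterRegular]
    [IsFiniteMeasure σ] {ε : ℝ} (hε : 0 ≤ ε)
    (h : ∀ i ∈ F, (ν i ⊓ σ) Set.univ < ENNReal.ofReal ε) :
    ∃ χ : C(X, ℝ), (∀ x, χ x ∈ Set.Icc (0 : ℝ) 1) ∧ (∀ i ∈ F, ∫ x, χ x ∂(ν i) ≤ ε) ∧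
      ∫ x, (1 - χ x) ∂σ ≤ F.card * ε := by
  have h' : ∀ i : F, _ := fun i => exists_open_cover_of_inf_lt (ν i) σ (h i i.2)
  choose U V hU hV hUV hνU hσV using h'
  have hUo : IsOpen (⋂ i, U i) := isOpen_iInter_of_finite hU
  have hVo : IsOpen (⋃ i, V i) := isOpen_iUnion hV
  have hcov : ∀ x, x ∉ ⋂ i, U i → x ∈ ⋃ i, V i := by
    intro x hx
    obtain ⟨i, hi⟩ := not_forall.1 (fun hall => hx (Set.mem_iInter.2 hall))
    exact Set.mem_iUnion.2 ⟨i, ((hUV i).symm ▸ Set.mem_univ x : x ∈ U i ∪ V i).resolve_left hi⟩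
  obtain ⟨χ, hχ0, hχ1, hχ⟩ := exists_continuous_zero_one_of_isClosed hUo.isClosed_compl
    hVo.isClosed_compl (Set.disjoint_left.2 fun x hx hx' => hx' (hcov x hx))
  refine ⟨χ, hχ, fun i hi => ?_, ?_⟩
  · have h1 := integral_le_measure (μ := ν i) (f := χ) (s := ⋂ i, U i) (fun x _ => (hχ x).2)
      fun x hx => (hχ0 hx).le
    have h2 := (h1.trans (measure_mono (Set.iInter_subset U ⟨i, hi⟩))).trans (hνU ⟨i, hi⟩)
    exact (ENNReal.ofReal_le_ofReal_iff hε).1 h2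
  · have h1 := integral_le_measure (μ := σ) (f := fun x => 1 - χ x) (s := ⋃ i, V i)
      (fun x _ => by linarith [(hχ x).1]) fun x hx => by
        have : χ x = 1 := hχ1 hx
        simp [this]
    have h2 : σ (⋃ i, V i) ≤ ENNReal.ofReal (F.card * ε) := by
      refine (measure_iUnion_fintype_le σ V).trans
        ((Finset.sum_le_sum fun i _ => hσV i).trans_eq ?_)
      rw [Finset.sum_const, nsmul_eq_mul, ENNReal.ofReal_mul (Nat.cast_nonneg _)]
      simp
    exact (ENNReal.ofReal_le_ofReal_iff (by positivity)).1 (h1.trans h2)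

variable [BorelSpace X]

/-- In a relatively weakly compact family of functionals that are uniformly non-trivial, every
dominating measure overlaps uniformly with one of finitely many members of the family. -/
theorem exists_uniform_overlap {ι : Type*} (μ : ι → StrongDual ℂ C(X, ℂ)) (ν : ι → Measure X)
    [∀ n, IsFiniteMeasure (ν n)] [∀ i, (ν i).OuterRegular]
    (hμν : ∀ n (g : C(X, ℂ)), ‖μ n g‖ ≤ ∫ x, ‖g x‖ ∂(ν n))
    (K : Set (WeakSpace ℂ (StrongDual ℂ C(X, ℂ)))) (hK : IsCompact K)
    (hμ : ∀ n, toWeakSpace ℂ (StrongDual ℂ C(X, ℂ)) (μ n) ∈ K)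
    (f : ι → C(X, ℂ)) (hf : ∀ n x, ‖f n x‖ ≤ 1) (c : ℂ) (hc0 : c ≠ 0) (hc : ∀ n, μ n (f n) = c) :
    ∃ F : Finset ι, ∃ ε : ℝ, 0 < ε ∧
      ∀ j, ∃ i ∈ F, ENNReal.ofReal ε ≤ (ν i ⊓ ν j) Set.univ := by
  by_contra! hcon
  have hcpos : 0 < ‖c‖ := norm_pos_iff.2 hc0
  set δ := ‖c‖ / 20 with hδdef
  have hδ : 0 < δ := by positivity
  -- The power gives the geometric decay; dividing by `n + 1` absorbs the union over `n` earlier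
  -- measures.
  let e : ℕ → ℝ := fun n => δ * (1 / 2) ^ n / (n + 1)
  have he : ∀ n, 0 < e n := fun n => by positivity
  have hanti : Antitone e := by
    intro m n hmn
    have h1 : ((1 : ℝ) / 2) ^ n ≤ (1 / 2) ^ m :=
      pow_le_pow_of_le_one (by norm_num) (by norm_num) hmn
    have h2 : (m : ℝ) ≤ n := Nat.cast_le.2 hmn
    exact div_le_div₀ (by positivity) (mul_le_mul_of_nonneg_left h1 hδ.le) (by positivity)
      (by linarith)
  -- The selection principle does not see the position in the sequence, so each index carries a
  -- level. Levels strictly increase, hence the `n`-th is at least `n`.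
  obtain ⟨a, -, ha⟩ := exists_seq_of_forall_finset_exists (α := ι × ℕ) (fun _ => True)
    (fun x y => x.2 < y.2 ∧ (ν x.1 ⊓ ν y.1) Set.univ < ENNReal.ofReal (e y.2)) (by
      classical
      intro s _
      obtain ⟨j, hj⟩ := hcon (s.image Prod.fst) (e (s.sup Prod.snd + 1)) (he _)
      exact ⟨(j, s.sup Prod.snd + 1), trivial, fun x hx =>
        ⟨Nat.lt_succ_of_le (Finset.le_sup (f := Prod.snd) hx),
          hj _ (Finset.mem_image_of_mem _ hx)⟩⟩)
  have hmono : StrictMono fun n => (a n).2 := fun m n hmn => (ha m n hmn).1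
  have hχ : ∀ n, ∃ χ : C(X, ℝ), (∀ x, χ x ∈ Set.Icc (0 : ℝ) 1) ∧
      (∀ i ∈ Finset.range n, ∫ x, χ x ∂(ν (a i).1) ≤ e n) ∧
      ∫ x, (1 - χ x) ∂(ν (a n).1) ≤ (Finset.range n).card * e n := fun n =>
    exists_continuous_separating (Finset.range n) (fun i => ν (a i).1) (ν (a n).1) (he n).le
      fun i hi => (ha i n (Finset.mem_range.1 hi)).2.trans_le
        (ENNReal.ofReal_le_ofReal (hanti (hmono.le_apply (x := n))))
  choose χ hχ01 hχ0 hχ1 using hχ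
  have := norm_le_of_almost_disjoint (fun n => μ (a n).1) (fun n => ν (a n).1)
    (fun n => hμν _) K hK (fun n => hμ _) (fun n => f (a n).1) (fun n => hf _) c (fun n => hc _)
    χ hχ01 δ hδ.le
    (fun i n hin => (hχ0 n i (Finset.mem_range.2 hin)).trans
      (div_le_self (by positivity) (by linarith [(Nat.cast_nonneg n : (0 : ℝ) ≤ n)])))
    (fun n => (hχ1 n).trans (by
      have h1 : ((1 : ℝ) / 2) ^ n ≤ 1 := pow_le_one₀ (by norm_num) (by norm_num)
      rw [Finset.card_range, mul_div_assoc', div_le_iff₀ (by positivity)]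
      have h0 : (0 : ℝ) ≤ n := Nat.cast_nonneg n
      nlinarith [mul_le_mul_of_nonneg_left h1 hδ.le, mul_nonneg h0 hδ.le]))
  linarith

end UniformOverlap

/-! ### The overlap form and its lower bound. -/

section OverlapForm

variable {X ι : Type*} [TopologicalSpace X] [CompactSpace X] [MeasurableSpace X] [BorelSpace X]

theorem ContinuousMap.integrable_of_isFiniteMeasure (f : C(X, ℝ)) (ρ : Measure X)
    [IsFiniteMeasure ρ] : Integrable f ρ :=
  f.continuous.integrable_of_hasCompactSupport (.of_compactSpace _)

/-- The bilinear forms `(u, v) ↦ ∑ᵢⱼ uᵢ vⱼ ∫ f d(νᵢ ⊓ νⱼ)` on finitely supported functions. -/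
noncomputable def overlapForm (ν : ι → Measure X) [∀ i, IsFiniteMeasure (ν i)] :
    C(X, ℝ) →ₗ[ℝ] (ι →₀ ℝ) →ₗ[ℝ] (ι →₀ ℝ) →ₗ[ℝ] ℝ where
  toFun f := Finsupp.linearCombination ℝ fun i =>
    Finsupp.linearCombination ℝ fun j => ∫ x, f x ∂(ν i ⊓ ν j)
  map_add' f g := by
    ext i j
    have := isFiniteMeasure_inf (ν i) (ν j)
    simpa using integral_add (f.integrable_of_isFiniteMeasure (ν i ⊓ ν j))
      (g.integrable_of_isFiniteMeasure _)
  map_smul' c f := by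
    ext i j
    simpa using integral_const_mul c _

variable (ν : ι → Measure X) [∀ i, IsFiniteMeasure (ν i)]

theorem overlapForm_apply (f : C(X, ℝ)) (u v : ι →₀ ℝ) :
    overlapForm ν f u v =
      ∑ i ∈ u.support, ∑ j ∈ v.support, u i * v j * ∫ x, f x ∂(ν i ⊓ ν j) := by
  simp [overlapForm, Finsupp.linearCombination_apply, Finsupp.sum, LinearMap.sum_apply,
    Finset.mul_sum, mul_assoc]

theorem overlapForm_single (f : C(X, ℝ)) (i j : ι) :
    overlapForm ν f (Finsupp.single i 1) (Finsupp.single j 1) = ∫ x, f x ∂(ν i ⊓ ν j) := by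
  simp [overlapForm]

theorem overlapForm_comm (f : C(X, ℝ)) (u v : ι →₀ ℝ) :
    overlapForm ν f u v = overlapForm ν f v u := by
  rw [overlapForm_apply, overlapForm_apply, Finset.sum_comm]
  simp only [inf_comm, mul_comm]

theorem overlapForm_nonneg {f : C(X, ℝ)} (hf : 0 ≤ f) (u : ι →₀ ℝ) :
    0 ≤ overlapForm ν f u u := by
  rw [overlapForm_apply]
  exact sum_mul_integral_inf_nonneg _ ν u hf fun i => f.integrable_of_isFiniteMeasure _

/-- A homeomorphism commutes with infima of measures, so moving `f` amounts to permuting indices. -/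
theorem overlapForm_mapDomain (e : X ≃ₜ X) (s : ι → ι) (hν : ∀ i, (ν i).map e = ν (s i))
    (f : C(X, ℝ)) (u v : ι →₀ ℝ) :
    overlapForm ν (f.comp e) u v =
      overlapForm ν f (Finsupp.lmapDomain ℝ ℝ s u) (Finsupp.lmapDomain ℝ ℝ s v) := by
  have key : ∀ i j, ∫ x, f (e x) ∂(ν i ⊓ ν j) = ∫ x, f x ∂(ν (s i) ⊓ ν (s j)) := by
    intro i j
    rw [← hν, ← hν]
    have := map_inf_measurableEquiv e.toMeasurableEquiv (ν i) (ν j)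
    rw [Homeomorph.toMeasurableEquiv_coe] at this
    rw [← this, e.measurableEmbedding.integral_map]
  have : overlapForm ν (f.comp e) =
      (overlapForm ν f).compl₁₂ (Finsupp.lmapDomain ℝ ℝ s) (Finsupp.lmapDomain ℝ ℝ s) := by
    ext i j
    simpa [overlapForm] using key i j
  rw [this]
  rfl

/-- If every `νⱼ` overlaps uniformly with one of finitely many `νᵢ`, the overlap form is bounded
below on convex combinations. -/
theorem overlapForm_one_bounded_below (F : Finset ι) {ε : ℝ} (hε : 0 < ε)
    (hF : ∀ j, ∃ i ∈ F, ENNReal.ofReal ε ≤ (ν i ⊓ ν j) Set.univ) :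
    ∃ c : ℝ, 0 < c ∧ ∀ u ∈ convexHull ℝ (Set.range fun i : ι => (Finsupp.single i 1 : ι →₀ ℝ)),
      c ≤ overlapForm ν 1 u u := by
  -- Pairing with `ψ` is linear and at least `ε` at each point mass, hence on the hull;
  -- Cauchy–Schwarz converts this into a bound on `B 1 u u`.
  set ψ : ι →₀ ℝ := ∑ i ∈ F, Finsupp.single i 1
  have h1 : (0 : C(X, ℝ)) ≤ 1 := fun x => zero_le_one
  have hψ : 0 ≤ overlapForm ν 1 ψ ψ := overlapForm_nonneg ν h1 ψ
  have hval : ∀ i j, overlapForm ν 1 (Finsupp.single i 1) (Finsupp.single j 1) =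
      (ν i ⊓ ν j).real Set.univ := fun i j => by simp [overlapForm_single]
  have hlow : ∀ u ∈ convexHull ℝ (Set.range fun i : ι => (Finsupp.single i 1 : ι →₀ ℝ)),
      ε ≤ overlapForm ν 1 ψ u := by
    intro u hu
    refine convexHull_min (t := {u | ε ≤ overlapForm ν 1 ψ u}) ?_
      (convex_halfSpace_ge (overlapForm ν 1 ψ).isLinear ε) hu
    rintro _ ⟨j, rfl⟩
    obtain ⟨i, hi, hij⟩ := hF j
    have := isFiniteMeasure_inf (ν i) (ν j)
    have h2 : ε ≤ (ν i ⊓ ν j).real Set.univ :=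
      (ENNReal.ofReal_le_iff_le_toReal (measure_ne_top _ _)).1 hij
    refine h2.trans ?_
    simp only [ψ, map_sum, LinearMap.sum_apply, hval]
    exact Finset.single_le_sum (f := fun i => (ν i ⊓ ν j).real Set.univ)
      (fun _ _ => measureReal_nonneg) hi
  refine ⟨ε ^ 2 / (overlapForm ν 1 ψ ψ + 1), by positivity, fun u hu => ?_⟩
  have hcs := LinearMap.BilinForm.apply_sq_le_of_symm (overlapForm ν 1)
    (overlapForm_nonneg ν h1) ⟨fun x y => overlapForm_comm ν 1 x y⟩ ψ u
  rw [div_le_iff₀ (by positivity)]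
  have := pow_le_pow_left₀ hε.le (hlow u hu) 2
  nlinarith [overlapForm_nonneg ν h1 u]

end OverlapForm

/-! ### Haar measures from weakly compact orbits. -/

section HaarMeasure

variable {G : Type*} [TopologicalSpace G] [Group G] [IsRightTopologicalGroup G]

/-- Right translation as a homeomorphism. -/
def rightTranslateHomeomorph (g : G) : G ≃ₜ G where
  toEquiv := Equiv.mulRight g
  continuous_toFun := IsRightTopologicalGroup.continuous_mul_right g
  continuous_invFun := IsRightTopologicalGroup.continuous_mul_right g⁻¹

variable [CompactSpace G]

theorem translateMeasure_inv_apply (μ : RadonDual G) (g : G) (f : C(G, ℂ)) :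
    translateMeasure μ g⁻¹ f = μ (rightTranslateFun g f) := by
  change μ (rightTranslateFun g⁻¹⁻¹ f) = _
  rw [inv_inv]

/-- Inversion, as a mere bijection, reparametrises the orbit as a continuous image of `G`. -/
theorem measureLc_subset_measureMw : measureLc G ⊆ measureMw G := by
  rintro μ ⟨hc, hcont⟩
  refine ⟨hc, ?_⟩
  have hrange : toWeakSpace ℂ (RadonDual G) '' rightOrbit μ =
      Set.range fun x : G => toWeakSpaceCLM ℂ (RadonDual G) (translateMeasure μ x⁻¹) := by
    rw [rightOrbit, ← (Equiv.inv G).surjective.range_comp, ← Set.range_comp]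
    rfl
  rw [hrange]
  exact (isCompact_range ((toWeakSpaceCLM ℂ (RadonDual G)).continuous.comp hcont)).closure

variable [MeasurableSpace G] [BorelSpace G]

theorem exists_measureLc_of_isRightHaarMeasure {m : Measure G} (hm : IsRightHaarMeasure m) :
    ∃ μ ∈ measureLc G, μ ≠ 0 := by
  have := hm.isProbabilityMeasure
  have hint : ∀ f : C(G, ℂ), Integrable f m := fun f =>
    f.continuous.integrable_of_hasCompactSupport (.of_compactSpace _)
  let μ : RadonDual G := LinearMap.mkContinuous
    { toFun := fun f => ∫ x, f x ∂m
      map_add' := fun f g => integral_add (hint f) (hint g)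
      map_smul' := fun c f => integral_smul c _ } 1 fun f => by
        simpa using norm_integral_le_of_norm_le_const (μ := m) (.of_forall f.norm_coe_le_norm)
  have hinv : ∀ g (f : C(G, ℂ)), μ (rightTranslateFun g f) = μ f := by
    intro g f
    set e := rightTranslateHomeomorph g
    have hmap : m.map e = m := by
      refine Measure.ext fun s hs => ?_
      rw [e.measurableEmbedding.map_apply, ← hm.right_invariant g _ (e.continuous.measurable hs)]
      exact congrArg m (e.image_preimage s)
    change ∫ x, f (e x) ∂m = ∫ x, f x ∂m
    rw [← e.measurableEmbedding.integral_map, hmap]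
  refine ⟨μ, ⟨fun f => ?_, ?_⟩, fun h => ?_⟩
  · have : funDotMeasure f μ = fun _ => μ f := funext fun y => hinv y f
    exact this ▸ continuous_const
  · have : (fun x : G => translateMeasure μ x⁻¹) = fun _ => μ := funext fun x =>
      ContinuousLinearMap.ext fun f => hinv _ f
    exact this ▸ continuous_const
  · have h1 : μ 1 = 1 := by
      change ∫ x, (1 : G → ℂ) x ∂m = 1
      simp
    rw [h] at h1
    exact zero_ne_one h1

variable [T2Space G]

/-- An invariant positive functional on `C(G, ℝ)` gives a Haar measure. -/
theorem exists_isRightHaarMeasure_of_functional (m : C(G, ℝ) →ₗ[ℝ] ℝ)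
    (hpos : ∀ f, 0 ≤ f → 0 ≤ m f) (h1 : 0 < m 1)
    (hinv : ∀ g f, m (f.comp ((rightTranslateHomeomorph g : G ≃ₜ G) : C(G, G))) = m f) :
    ∃ l : Measure G, IsRightHaarMeasure l := by
  let Λ₀ : CompactlySupportedContinuousMap G ℝ →ₗ[ℝ] ℝ :=
    { toFun := fun f => (m 1)⁻¹ * m f.toContinuousMap
      map_add' := fun f g => by
        rw [← mul_add, ← map_add]; rfl
      map_smul' := fun c f => by
        have : (c • f).toContinuousMap = c • f.toContinuousMap := rfl
        rw [this, map_smul, smul_eq_mul, RingHom.id_apply, smul_eq_mul]; ring }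
  let Λ : CompactlySupportedContinuousMap G ℝ →ₚ[ℝ] ℝ := PositiveLinearMap.mk₀ Λ₀ fun f hf =>
    mul_nonneg (inv_nonneg.2 h1.le) (hpos _ hf)
  set l := RealRMK.rieszMeasure Λ
  have hreg : l.Regular := RealRMK.regular_rieszMeasure Λ
  have hint : ∀ f : C(G, ℝ), ∫ x, f x ∂l = (m 1)⁻¹ * m f := fun f =>
    RealRMK.integral_rieszMeasure Λ ⟨f, HasCompactSupport.of_compactSpace _⟩
  have hprob : l.real Set.univ = 1 := by
    have := hint 1
    rw [inv_mul_cancel₀ h1.ne'] at this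
    simpa using this
  refine ⟨l, hreg, ⟨by rwa [← ENNReal.toReal_eq_one_iff]⟩, fun g E _ => ?_⟩
  set e := rightTranslateHomeomorph g
  have hmap : l.map e = l := by
    have : (l.map e).Regular := Measure.Regular.map e
    refine Measure.ext_of_integral_eq_on_compactlySupported fun f => ?_
    rw [e.measurableEmbedding.integral_map]
    exact (hint (f.toContinuousMap.comp e)).trans
      ((congrArg _ (hinv g _)).trans (hint f.toContinuousMap).symm)
  change l (e '' E) = l E
  conv_lhs => rw [← hmap]
  rw [e.measurableEmbedding.map_apply, e.preimage_image]

theorem exists_isRightHaarMeasure_of_measureMw {μ : RadonDual G} (hμ : μ ∈ measureMw G)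
    (h0 : μ ≠ 0) : ∃ m : Measure G, IsRightHaarMeasure m := by
  obtain ⟨ν₀, hreg, hfin, hdom⟩ := exists_regular_measure_dominating μ
  obtain ⟨f₀, hf₀⟩ : ∃ f, μ f ≠ 0 := by
    by_contra! h
    exact h0 (ContinuousLinearMap.ext h)
  have hn : 0 < ‖f₀‖ := norm_pos_iff.2 fun h => hf₀ (by rw [h, map_zero])
  set f₁ : C(G, ℂ) := ((‖f₀‖⁻¹ : ℝ) : ℂ) • f₀
  have hf₁ : ∀ x, ‖f₁ x‖ ≤ 1 := fun x => by
    have := f₀.norm_coe_le_norm x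
    simp only [f₁, ContinuousMap.smul_apply, norm_smul, Complex.norm_real, norm_inv, norm_norm]
    rwa [inv_mul_le_iff₀ hn, mul_one]
  have hμf₁ : μ f₁ ≠ 0 := by
    simp only [f₁, map_smul]
    exact smul_ne_zero (Complex.ofReal_ne_zero.2 (inv_ne_zero hn.ne')) hf₀
  let ν : G → Measure G := fun g => ν₀.map (rightTranslateHomeomorph g)
  have hνreg : ∀ g, (ν g).Regular := fun g => Measure.Regular.map _
  have hνfin : ∀ g, IsFiniteMeasure (ν g) := fun g => Measure.isFiniteMeasure_map _ _
  obtain ⟨F, ε, hε, hF⟩ := exists_uniform_overlap (fun g => translateMeasure μ g⁻¹) ν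
    (fun g f => by
      rw [(rightTranslateHomeomorph g).measurableEmbedding.integral_map,
        translateMeasure_inv_apply]
      exact hdom _)
    _ hμ.2 (fun g => subset_closure ⟨_, ⟨g⁻¹, rfl⟩, rfl⟩)
    -- Moving the test function back with the translate keeps the value `μ f₁` the same along the
    -- orbit.
    (fun g => rightTranslateFun g⁻¹ f₁) (fun g x => hf₁ _) (μ f₁) hμf₁ (fun g => by
      rw [translateMeasure_inv_apply]
      congr 1
      ext x
      change f₁ (x * g * g⁻¹) = f₁ x
      rw [mul_inv_cancel_right])
  obtain ⟨c, hc, hlow⟩ := overlapForm_one_bounded_below ν F hε hF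
  have hνmap : ∀ t g, (ν g).map (rightTranslateHomeomorph t) = ν (g * t) := by
    intro t g
    rw [Measure.map_map (rightTranslateHomeomorph t).continuous.measurable
      (rightTranslateHomeomorph g).continuous.measurable]
    congr 1
    ext x
    exact mul_assoc x g t
  obtain ⟨m, hm, hm1, hinv⟩ := exists_invariant_functional (overlapForm ν)
    (overlapForm_comm ν) (fun f hf => overlapForm_nonneg ν hf) _ (convex_convexHull ℝ _)
    ((Set.range_nonempty _).convexHull) c hc hlow
    (fun t : G => Finsupp.lmapDomain ℝ ℝ fun g => g * t)
    (fun t => { toFun := fun f => f.comp ((rightTranslateHomeomorph t : G ≃ₜ G) : C(G, G))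
                map_add' := fun _ _ => rfl
                map_smul' := fun _ _ => rfl })
    (fun t u hu => by
      refine convexHull_min ?_ ((convex_convexHull ℝ _).linear_preimage
        (Finsupp.lmapDomain ℝ ℝ fun g : G => g * t)) hu
      rintro _ ⟨g, rfl⟩
      refine subset_convexHull ℝ _ ⟨g * t, ?_⟩
      simp)
    (fun t => rfl)
    (fun t f u => overlapForm_mapDomain ν (rightTranslateHomeomorph t) (fun g => g * t)
      (hνmap t) f u u)
  exact exists_isRightHaarMeasure_of_functional m hm hm1 hinv

end HaarMeasure

theorem mainTheorem4 (G : Type*) [TopologicalSpace G] [CompactSpace G] [T2Space G] [Group G]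
    [IsRightTopologicalGroup G] [MeasurableSpace G] [BorelSpace G] :
    List.TFAE
      [∃ m : Measure G, IsRightHaarMeasure m,
       ∃ μ ∈ measureLc G, μ ≠ 0,
       ∃ μ ∈ measureMw G, μ ≠ 0] := by
  tfae_have 1 → 2 := fun ⟨_, hm⟩ => exists_measureLc_of_isRightHaarMeasure hm
  tfae_have 2 → 3 := fun ⟨μ, hμ, h0⟩ => ⟨μ, measureLc_subset_measureMw hμ, h0⟩
  tfae_have 3 → 1 := fun ⟨_, hμ, h0⟩ => exists_isRightHaarMeasure_of_measureMw hμ h0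
  tfae_finish
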